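/- Setting. Rational Pavelka predicate logic $\mathrm{RPL}\forall$ over a predicate language with function and predicate symbols of arbitrary finite arities and a distinguished binary predicate symbol $\approx$. Formulas are built from atomic formulas $P(t_1,\dots,t_n)$ and truth constants $\overline r$ ($r\in[0,1]\cap\mathbb Q$) by $\to$ and $\forall$, with $\neg\varphi:=\varphi\to\overline 0$, $\varphi\&\psi:=\neg(\varphi\to\neg\psi)$, $\varphi\leftrightarrow\psi:=(\varphi\to\psi)\&(\psi\to\varphi)$, $(\exists x)\varphi:=\neg(\forall x)\neg\varphi$. Provability $\vdash$ is given by the axioms $\varphi\to(\psi\to\varphi)$; $(\varphi\to\psi)\to((\psi\to\xi)\to(\varphi\to\xi))$; $(\neg\psi\to\neg\varphi)\to(\varphi\to\psi)$; $((\varphi\to\psi)\to\psi)\to((\psi\to\varphi)\to\varphi)$; $(\overline r\to\overline s)\leftrightarrow\overline{\min(1-r+s,1)}$; $(\overline r\&\overline s)\leftrightarrow\overline{\max(r+s-1,0)}$; $(\forall x)\varphi\to\varphi(t/x)$ for $t$ substitutable for $x$ in $\varphi$; $(\forall x)(\xi\to\varphi)\to(\xi\to(\forall x)\varphi)$ for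 $x$ not free in $\xi$; the (universally quantified) axioms saying that $\approx$ is reflexive, symmetric ($x\approx y\to y\approx x$) and transitive ($x\approx y\,\&\,y\approx z\to x\approx z$) and a congruence ($x_1\approx y_1\&\cdots\& x_n\approx y_n\to F(\vec x)\approx F(\vec y)$ and $x_1\approx y_1\&\cdots\& x_n\approx y_n\to (P(\vec x)\leftrightarrow P(\vec y))$ for all function symbols $F$ and predicate symbols $P$); and the rules modus ponens and generalization. A theory $\Phi$ is a set of sentences; it is consistent if $\Phi\nvdash\overline 0$. The provability degree is $|\varphi|_\Phi=\sup\{r\in[0,1]\cap\mathbb Q : \Phi\vdash\overline r\to\varphi\}$. A structure $\mathbf M$ has a non-empty domain $M$, functions $F_{\mathbf M}:M^n\to M$ and fuzzy relations $P_{\mathbf M}:M^n\to[0,1]$. Truth values $\|\varphi\|_{\mathbf M,v}\in[0,1]$ under evaluations $v$ of the variables are computed by the standard Łukasiewicz semantics ($\to$ as $\min(1-a+b,1)$, $\forall$ as infimum), and $\|\varphi\|_{\mathbf M}=\inf_v\|\varphi\|_{\mathbf M,v}$. A model of $\Phi$ is a structure in which the axioms for $\approx$ and all members of $\Phi$ have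 value $1$. A structure is reduced if $(d\approx_{\mathbf M} e)=1$ exactly when $d=e$. A homomorphism $g:\mathbf M\to\mathbf N$ is a map with $g(F_{\mathbf M}(\vec d))=F_{\mathbf N}(g(\vec d))$ and $P_{\mathbf M}(\vec d)=1\Rightarrow P_{\mathbf N}(g(\vec d))=1$. The term structure $\mathbf T^\Phi$ has as domain the classes $\overline t$ of all terms $t$ (variables allowed) modulo $t_1\sim t_2\iff|t_1\approx t_2|_\Phi=1$, with $F_{\mathbf T^\Phi}(\overline{t_1},\dots,\overline{t_n})=\overline{F(t_1,\dots,t_n)}$ and $P_{\mathbf T^\Phi}(\overline{t_1},\dots,\overline{t_n})=|P(t_1,\dots,t_n)|_\Phi$. An evaluated atomic formula is $(\alpha,r):=\overline r\to\alpha$ with $\alpha=P(t_1,\dots,t_n)$ and $r\in[0,1]\cap\mathbb Q$. A basic Horn formula is $(\alpha_1,r_1)\&\cdots\&(\alpha_n,r_n)\to(\beta,s)$ with evaluated atomic formulas, $n\ge0$ (for $n=0$ it is $(\beta,s)$). A Horn clause is a (possibly empty) string of universal quantifiers followed by a strong conjunction $\phi_1\&\cdots\&\phi_m$, $m\ge1$,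 of basic Horn formulas. (Conjunctions may be bracketed in any way.) Theorem 4.4. Let $\Phi$ be a consistent theory over $\mathrm{RPL}\forall$. (1) For every Horn clause $\varphi$ without free variables, if $|\varphi|_\Phi=1$, then $\|\varphi\|_{\mathbf T^\Phi}=1$. (2) Consequently, if all members of $\Phi$ are Horn clauses, then $\mathbf T^\Phi$ is a model of $\Phi$, and it is free on the class of all reduced models of $\Phi$: it is itself a reduced model of $\Phi$, and for every reduced model $\mathbf N$ of $\Phi$ and every evaluation $v$ of the variables in $\mathbf N$ there is a unique homomorphism $g:\mathbf T^\Phi\to\mathbf N$ with $g(\overline x)=v(x)$ for every variable $x$. -/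

import Mathlib

/-!  Rational Pavelka predicate logic with similarity, its standard semantics on the real unit
interval, provability degrees, Horn clauses, and the term structure of a theory. -/


universe u v w w'

namespace RPL

/-- A predicate language: function symbols and predicate symbols of every finite arity, with a
distinguished binary predicate symbol `sim` (written `≈` in the comments). -/
structure SimLanguage extends FirstOrder.Language.{u, v} where
  sim : Relations 2

/-- The rational numbers in the unit interval. -/
abbrev QI : Type := Set.Icc (0 : ℚ) 1

namespace QI

/-- The Łukasiewicz implication on truth constants. -/
def imp (r s : QI) : QI :=
  ⟨min (1 - r.1 + s.1) 1, le_min (by linarith [r.2.2, s.2.1]) zero_le_one, min_le_right _ _⟩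

/-- The Łukasiewicz strong conjunction on truth constants. -/
def and (r s : QI) : QI :=
  ⟨max (r.1 + s.1 - 1) 0, le_max_right _ _, max_le (by linarith [r.2.2, s.2.2]) zero_le_one⟩

end QI

/-- Terms; the object variables are indexed by the natural numbers. -/
abbrev Tm (L : SimLanguage.{u, v}) : Type u := L.toLanguage.Term ℕ

/-- Formulas. Primitive are the rational truth constants, the atomic formulas, implication and
the universal quantifier. -/
inductive Formula (L : SimLanguage.{u, v}) : Type (max u v) where
  | const (r : QI) : Formula L
  | rel {n : ℕ} (P : L.Relations n) (ts : Fin n → Tm L) : Formula L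
  | imp (φ ψ : Formula L) : Formula L
  | all (x : ℕ) (φ : Formula L) : Formula L

namespace Formula

variable {L : SimLanguage.{u, v}}

/-- Negation, `φ → 0`. -/
def neg (φ : Formula L) : Formula L := φ.imp (const 0)

/-- Strong conjunction `&`, in Łukasiewicz logic `¬(φ → ¬ψ)`. -/
def and (φ ψ : Formula L) : Formula L := (φ.imp ψ.neg).neg

/-- Equivalence, `(φ → ψ) & (ψ → φ)`. -/
def iff (φ ψ : Formula L) : Formula L := (φ.imp ψ).and (ψ.imp φ)

/-- The existential quantifier, in Łukasiewicz logic `¬∀¬`. -/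
def ex (x : ℕ) (φ : Formula L) : Formula L := (all x φ.neg).neg

/-- The atomic formula `s ≈ t`. -/
def sim (s t : Tm L) : Formula L := rel L.sim ![s, t]

/-- Strong conjunction of a finite list of formulas (the constant `1` for the empty list). -/
def conj : List (Formula L) → Formula L
  | [] => const 1
  | [φ] => φ
  | φ :: ψ :: l => φ.and (conj (ψ :: l))

/-- A string of universal quantifiers in front of a formula. -/
def alls (xs : List ℕ) (φ : Formula L) : Formula L := xs.foldr all φ

/-- The variables with a free occurrence. -/
def freeVars : Formula L → Finset ℕ
  | const _ => ∅
  | rel _ ts => Finset.univ.biUnion fun i => (ts i).varFinset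
  | imp φ ψ => φ.freeVars ∪ ψ.freeVars
  | all x φ => φ.freeVars.erase x

/-- A sentence (closed formula). -/
def IsSentence (φ : Formula L) : Prop := φ.freeVars = ∅

/-- `φ.subst x t` replaces every free occurrence of `x` in `φ` by `t`. -/
def subst (x : ℕ) (t : Tm L) : Formula L → Formula L
  | const r => const r
  | rel P ts => rel P fun i => (ts i).subst (Function.update FirstOrder.Language.Term.var x t)
  | imp φ ψ => imp (φ.subst x t) (ψ.subst x t)
  | all y φ => if y = x then all y φ else all y (φ.subst x t)

/-- `t` is substitutable for `x`: no free occurrence of `x` lies in the scope of a quantifier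
that binds a variable of `t`. -/
def Substitutable (x : ℕ) (t : Tm L) : Formula L → Prop
  | const _ => True
  | rel _ _ => True
  | imp φ ψ => φ.Substitutable x t ∧ ψ.Substitutable x t
  | all y φ => x ∉ (all y φ).freeVars ∨ (y ∉ t.varFinset ∧ φ.Substitutable x t)

/-- The evaluated formula `(φ, r)`, that is `r → φ`. -/
def ev (φ : Formula L) (r : QI) : Formula L := (const r).imp φ

/-- Evaluated atomic formulas `(P(t₁,…,tₙ), r)`. -/
inductive IsEvAtomic : Formula L → Prop
  | mk {n : ℕ} (P : L.Relations n) (ts : Fin n → Tm L) (r : QI) : IsEvAtomic ((rel P ts).ev r)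

/-- `IsConjOf S φ`: `φ` is a strong conjunction `φ₁ & ⋯ & φₘ`, `m ≥ 1`, of members of `S`,
with any bracketing. -/
inductive IsConjOf (S : Formula L → Prop) : Formula L → Prop
  | single {φ : Formula L} : S φ → IsConjOf S φ
  | and {φ ψ : Formula L} : IsConjOf S φ → IsConjOf S ψ → IsConjOf S (φ.and ψ)

/-- Basic Horn formulas `(α₁,r₁) & ⋯ & (αₙ,rₙ) → (β,s)`; for `n = 0` this is `(β,s)`. -/
inductive IsBasicHorn : Formula L → Prop
  | ev {β : Formula L} : IsEvAtomic β → IsBasicHorn β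
  | imp {α β : Formula L} : IsConjOf IsEvAtomic α → IsEvAtomic β → IsBasicHorn (α.imp β)

/-- Quantifier-free Horn formulas: strong conjunctions of basic Horn formulas. -/
def IsQFHorn (φ : Formula L) : Prop := IsConjOf IsBasicHorn φ

/-- Horn clauses: a (possibly empty) string of universal quantifiers in front of a
quantifier-free Horn formula. -/
def IsHornClause (φ : Formula L) : Prop :=
  ∃ (xs : List ℕ) (γ : Formula L), γ.IsQFHorn ∧ φ = alls xs γ

end Formula

open Formula

section Provability

variable {L : SimLanguage.{u, v}}

/-- The axioms of similarity and congruence; the displayed variables are pairwise distinct. -/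
inductive SimAxiom : Formula L → Prop
  | refl (x : ℕ) : SimAxiom (all x (sim (.var x) (.var x)))
  | symm (x y : ℕ) (h : [x, y].Nodup) :
      SimAxiom (all x (all y ((sim (.var x) (.var y)).imp (sim (.var y) (.var x)))))
  | trans (x y z : ℕ) (h : [x, y, z].Nodup) :
      SimAxiom (all x (all y (all z
        (((sim (.var x) (.var y)).and (sim (.var y) (.var z))).imp (sim (.var x) (.var z))))))
  | congrFun {n : ℕ} (F : L.Functions n) (x y : Fin n → ℕ)
      (h : Function.Injective (Sum.elim x y)) :
      SimAxiom (alls (List.ofFn x ++ List.ofFn y)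
        ((conj (List.ofFn fun i => sim (.var (x i)) (.var (y i)))).imp
          (sim (.func F fun i => .var (x i)) (.func F fun i => .var (y i)))))
  | congrRel {n : ℕ} (P : L.Relations n) (x y : Fin n → ℕ)
      (h : Function.Injective (Sum.elim x y)) :
      SimAxiom (alls (List.ofFn x ++ List.ofFn y)
        ((conj (List.ofFn fun i => sim (.var (x i)) (.var (y i)))).imp
          ((rel P fun i => .var (x i)).iff (rel P fun i => .var (y i)))))

/-- Provability in rational Pavelka predicate logic (with similarity) from a set of formulas. -/
inductive Provable (Φ : Set (Formula L)) : Formula L → Prop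
  | hyp {φ : Formula L} : φ ∈ Φ → Provable Φ φ
  | luk1 (φ ψ : Formula L) : Provable Φ (φ.imp (ψ.imp φ))
  | luk2 (φ ψ ξ : Formula L) : Provable Φ ((φ.imp ψ).imp ((ψ.imp ξ).imp (φ.imp ξ)))
  | luk3 (φ ψ : Formula L) : Provable Φ ((ψ.neg.imp φ.neg).imp (φ.imp ψ))
  | luk4 (φ ψ : Formula L) : Provable Φ (((φ.imp ψ).imp ψ).imp ((ψ.imp φ).imp φ))
  | rpl1 (r s : QI) : Provable Φ (((const r).imp (const s)).iff (const (r.imp s)))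
  | rpl2 (r s : QI) : Provable Φ (((const r).and (const s)).iff (const (r.and s)))
  | all1 (x : ℕ) (φ : Formula L) (t : Tm L) (h : φ.Substitutable x t) :
      Provable Φ ((all x φ).imp (φ.subst x t))
  | all2 (x : ℕ) (ξ φ : Formula L) (h : x ∉ ξ.freeVars) :
      Provable Φ ((all x (ξ.imp φ)).imp (ξ.imp (all x φ)))
  | simAx {φ : Formula L} : SimAxiom φ → Provable Φ φ
  | mp {φ ψ : Formula L} : Provable Φ φ → Provable Φ (φ.imp ψ) → Provable Φ ψ
  | gen (x : ℕ) {φ : Formula L} : Provable Φ φ → Provable Φ (all x φ)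

/-- A theory is a set of sentences. -/
def IsTheory (Φ : Set (Formula L)) : Prop := ∀ φ ∈ Φ, φ.IsSentence

/-- `Φ` is consistent if it does not prove the truth constant `0`. -/
def IsConsistent (Φ : Set (Formula L)) : Prop := ¬ Provable Φ (const 0)

/-- The provability degree `|φ|_Φ = sup {r | Φ ⊢ r → φ}`. -/
noncomputable def provDegree (Φ : Set (Formula L)) (φ : Formula L) : ℝ :=
  sSup {q : ℝ | ∃ r : QI, q = ((r : ℚ) : ℝ) ∧ Provable Φ ((const r).imp φ)}

end Provability

/-- A structure for the language, over the standard algebra on the real unit interval. -/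
structure Struc (L : SimLanguage.{u, v}) where
  Carrier : Type w
  nonempty : Nonempty Carrier
  fn : ∀ {n : ℕ}, L.Functions n → (Fin n → Carrier) → Carrier
  pr : ∀ {n : ℕ}, L.Relations n → (Fin n → Carrier) → unitInterval

namespace Struc

variable {L : SimLanguage.{u, v}}

/-- The value of a term under an evaluation of the variables. -/
def eval (M : Struc.{u, v, w} L) (e : ℕ → M.Carrier) : Tm L → M.Carrier
  | .var x => e x
  | .func F ts => M.fn F fun i => M.eval e (ts i)

/-- The truth value of a formula under an evaluation; all values lie in `[0,1]`, see
`value_mem`. -/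
noncomputable def value (M : Struc.{u, v, w} L) : (ℕ → M.Carrier) → Formula L → ℝ
  | _, .const r => ((r : ℚ) : ℝ)
  | e, .rel P ts => (M.pr P fun i => M.eval e (ts i) : ℝ)
  | e, .imp φ ψ => min (1 - M.value e φ + M.value e ψ) 1
  | e, .all x φ => ⨅ a : M.Carrier, M.value (Function.update e x a) φ

/-- The truth value of a formula in a structure: the infimum over all evaluations. -/
noncomputable def truth (M : Struc.{u, v, w} L) (φ : Formula L) : ℝ :=
  ⨅ e : ℕ → M.Carrier, M.value e φ

/-- Models of a theory. Similarity and congruence belong to the logic, so they have to hold. -/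
def IsModel (M : Struc.{u, v, w} L) (Φ : Set (Formula L)) : Prop :=
  (∀ φ : Formula L, SimAxiom φ → M.truth φ = 1) ∧ ∀ φ ∈ Φ, M.truth φ = 1

/-- A structure is reduced if it has the equality property: `d ≈ e` has value `1` exactly
when `d = e`. -/
def IsReduced (M : Struc.{u, v, w} L) : Prop :=
  ∀ d e : M.Carrier, M.pr L.sim ![d, e] = 1 ↔ d = e

theorem value_mem (M : Struc.{u, v, w} L) (φ : Formula L) (e : ℕ → M.Carrier) :
    M.value e φ ∈ Set.Icc (0 : ℝ) 1 := by
  have := M.nonempty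
  induction φ generalizing e with
  | const r => exact ⟨by simpa [value] using r.2.1, by simpa [value] using mod_cast r.2.2⟩
  | rel P ts => exact (M.pr P _).2
  | imp φ ψ h1 h2 =>
    exact ⟨le_min (by linarith [(h1 e).2, (h2 e).1]) zero_le_one, min_le_right _ _⟩
  | all x φ h =>
    have hb : BddBelow (Set.range fun a => M.value (Function.update e x a) φ) :=
      ⟨0, by rintro _ ⟨a, rfl⟩; exact (h _).1⟩
    exact ⟨le_ciInf fun a => (h _).1,
      (ciInf_le hb (Classical.arbitrary M.Carrier)).trans (h _).2⟩

theorem value_and (M : Struc.{u, v, w} L) (φ ψ : Formula L) (e : ℕ → M.Carrier) :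
    M.value e (φ.and ψ) = max (M.value e φ + M.value e ψ - 1) 0 := by
  have h1 := M.value_mem φ e
  have h2 := M.value_mem ψ e
  have h0 : (((0 : QI) : ℚ) : ℝ) = 0 := by simp
  simp only [Formula.and, Formula.neg, value, h0]
  obtain ⟨_, _⟩ := h1
  obtain ⟨_, _⟩ := h2
  rw [min_eq_left (a := 1 - M.value e ψ + 0) (by linarith)]
  rcases le_total (M.value e φ + M.value e ψ - 1) 0 with h | h
  · rw [max_eq_right h, min_eq_right (a := 1 - M.value e φ + _) (by linarith)]
    norm_num
  · rw [max_eq_left h, min_eq_left (a := 1 - M.value e φ + _) (by linarith),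
      min_eq_left (by linarith)]
    ring

theorem value_neg (M : Struc.{u, v, w} L) (φ : Formula L) (e : ℕ → M.Carrier) :
    M.value e φ.neg = 1 - M.value e φ := by
  have h0 : (((0 : QI) : ℚ) : ℝ) = 0 := by simp
  simp only [Formula.neg, value, h0]
  rw [min_eq_left (by linarith [(M.value_mem φ e).1]), add_zero]

theorem value_ex (M : Struc.{u, v, w} L) (x : ℕ) (φ : Formula L) (e : ℕ → M.Carrier) :
    M.value e (φ.ex x) = ⨆ a : M.Carrier, M.value (Function.update e x a) φ := by
  have := M.nonempty
  have hb : BddAbove (Set.range fun a => M.value (Function.update e x a) φ) :=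
    ⟨1, by rintro _ ⟨a, rfl⟩; exact (M.value_mem _ _).2⟩
  have hb' : BddBelow (Set.range fun a => 1 - M.value (Function.update e x a) φ) :=
    ⟨0, by rintro _ ⟨a, rfl⟩; simpa using (M.value_mem _ _).2⟩
  simp only [Formula.ex, value_neg, value]
  refine le_antisymm ?_ (ciSup_le fun a => by linarith [ciInf_le hb' a])
  have : 1 - (⨆ a, M.value (Function.update e x a) φ) ≤
      ⨅ a, (1 - M.value (Function.update e x a) φ) :=
    le_ciInf fun a => by linarith [le_ciSup hb a]
  linarith

end Struc

/-- Homomorphisms of structures: they commute with the function symbols and preserve the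
truth value `1` of the predicate symbols. -/
structure IsHom {L : SimLanguage.{u, v}} (M : Struc.{u, v, w} L) (N : Struc.{u, v, w'} L)
    (g : M.Carrier → N.Carrier) : Prop where
  map_fn : ∀ {n : ℕ} (F : L.Functions n) (d : Fin n → M.Carrier),
    g (M.fn F d) = N.fn F fun i => g (d i)
  map_pr : ∀ {n : ℕ} (P : L.Relations n) (d : Fin n → M.Carrier),
    M.pr P d = 1 → (N.pr P fun i => g (d i)) = 1

/-! Derivations needed to see that the term structure is well defined. -/

section Derivations

variable {L : SimLanguage.{u, v}} {Φ : Set (Formula L)}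

namespace Provable

theorem tr {a b c : Formula L} (h1 : Provable Φ (a.imp b)) (h2 : Provable Φ (b.imp c)) :
    Provable Φ (a.imp c) := mp h2 (mp h1 (luk2 a b c))

theorem app (a b : Formula L) : Provable Φ (a.imp ((a.imp b).imp b)) :=
  tr (luk1 a (b.imp a)) (luk4 b a)

theorem exch {a b c : Formula L} (h : Provable Φ (a.imp (b.imp c))) :
    Provable Φ (b.imp (a.imp c)) := tr (app b c) (mp h (luk2 a (b.imp c) c))

theorem idt (a : Formula L) : Provable Φ (a.imp a) :=
  mp (luk1 a a) (exch (luk1 a (a.imp (a.imp a))))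

theorem exF (a : Formula L) : Provable Φ ((const 0).imp a) :=
  mp (mp (idt (const 0)) (luk1 _ _)) (luk3 (const 0) a)

theorem dneg (a : Formula L) : Provable Φ (a.neg.neg.imp a) :=
  mp (exF a) (exch (luk4 a (const 0)))

theorem contra {a b : Formula L} (h : Provable Φ (a.imp b)) : Provable Φ (b.neg.imp a.neg) :=
  mp h (luk2 a b (const 0))

theorem curry {a b c : Formula L} (h : Provable Φ ((a.and b).imp c)) :
    Provable Φ (a.imp (b.imp c)) := by
  have h1 : Provable Φ (c.neg.imp (a.imp b.neg)) := tr (contra h) (dneg _)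
  exact tr (exch h1) (luk3 b c)

theorem uncurry {a b c : Formula L} (h : Provable Φ (a.imp (b.imp c))) :
    Provable Φ ((a.and b).imp c) := by
  have h1 : Provable Φ (a.imp (c.neg.imp b.neg)) := tr h (luk2 b c (const 0))
  exact tr (contra (exch h1)) (dneg c)

theorem and_left (a b : Formula L) : Provable Φ ((a.and b).imp a) := uncurry (luk1 a b)

theorem and_right (a b : Formula L) : Provable Φ ((a.and b).imp b) := uncurry (exch (luk1 b a))

theorem const_one : Provable Φ (const 1) := by
  have h : ((0 : QI).imp 0) = 1 := by ext; simp [QI.imp]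
  have := mp (rpl1 (Φ := Φ) 0 0) (and_left _ _)
  rw [h] at this
  exact mp (idt _) this

theorem const_mono {r s : QI} (h : r ≤ s) : Provable Φ ((const r).imp (const s)) := by
  have h' : r.imp s = 1 := by
    ext
    have : (r : ℚ) ≤ s := h
    simp only [QI.imp, Set.Icc.coe_one]
    exact min_eq_right (by linarith)
  have := mp (rpl1 (Φ := Φ) r s) (and_right _ _)
  rw [h'] at this
  exact mp const_one this

theorem bound_mp {r s : QI} {a b : Formula L} (h1 : Provable Φ ((const r).imp (a.imp b)))
    (h2 : Provable Φ ((const s).imp a)) : Provable Φ ((const (r.and s)).imp b) :=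
  tr (mp (rpl2 r s) (and_right _ _)) (uncurry (exch (tr h2 (exch h1))))

end Provable

theorem provDegree_bddAbove (Φ : Set (Formula L)) (φ : Formula L) :
    BddAbove {q : ℝ | ∃ r : QI, q = ((r : ℚ) : ℝ) ∧ Provable Φ ((const r).imp φ)} :=
  ⟨1, by rintro _ ⟨r, rfl, -⟩; exact mod_cast r.2.2⟩

theorem provDegree_mem (Φ : Set (Formula L)) (φ : Formula L) :
    provDegree Φ φ ∈ Set.Icc (0 : ℝ) 1 := by
  constructor
  · exact le_csSup (provDegree_bddAbove Φ φ) ⟨0, by simp, Provable.exF φ⟩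
  · refine csSup_le ⟨0, 0, by simp, Provable.exF φ⟩ ?_
    rintro _ ⟨r, rfl, -⟩
    exact mod_cast r.2.2

theorem le_provDegree {φ : Formula L} {r : QI} (h : Provable Φ ((const r).imp φ)) :
    ((r : ℚ) : ℝ) ≤ provDegree Φ φ := le_csSup (provDegree_bddAbove Φ φ) ⟨r, rfl, h⟩

theorem exists_of_lt_provDegree {φ : Formula L} {q : ℝ} (h : q < provDegree Φ φ) :
    ∃ r : QI, q < ((r : ℚ) : ℝ) ∧ Provable Φ ((const r).imp φ) := by
  obtain ⟨_, ⟨r, rfl, hr⟩, hq⟩ := exists_lt_of_lt_csSup (s := {q : ℝ | ∃ r : QI,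
    q = ((r : ℚ) : ℝ) ∧ Provable Φ ((const r).imp φ)}) ⟨0, 0, by simp, Provable.exF φ⟩ h
  exact ⟨r, hq, hr⟩

theorem provDegree_of_provable {φ : Formula L} (h : Provable Φ φ) : provDegree Φ φ = 1 := by
  refine le_antisymm (provDegree_mem Φ φ).2 ?_
  have := le_provDegree (Φ := Φ) (r := 1) (.mp h (.luk1 φ (const 1)))
  simpa using this

theorem provDegree_mp (φ ψ : Formula L) :
    provDegree Φ (φ.imp ψ) + provDegree Φ φ - 1 ≤ provDegree Φ ψ := by
  refine le_of_forall_pos_le_add fun ε hε => ?_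
  obtain ⟨r, hr, h1⟩ := exists_of_lt_provDegree (Φ := Φ) (φ := φ.imp ψ)
    (q := provDegree Φ (φ.imp ψ) - ε / 2) (by linarith)
  obtain ⟨s, hs, h2⟩ := exists_of_lt_provDegree (Φ := Φ) (φ := φ)
    (q := provDegree Φ φ - ε / 2) (by linarith)
  have h3 := le_provDegree (Provable.bound_mp h1 h2)
  have h4 : ((r : ℚ) : ℝ) + ((s : ℚ) : ℝ) - 1 ≤ (((r.and s : QI) : ℚ) : ℝ) := by
    have : (r : ℚ) + s - 1 ≤ (r.and s : QI).1 := le_max_left _ _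
    exact mod_cast this
  linarith

theorem provDegree_mono {φ ψ : Formula L} (h : Provable Φ (φ.imp ψ)) :
    provDegree Φ φ ≤ provDegree Φ ψ := by
  have := provDegree_mp (Φ := Φ) φ ψ
  rw [provDegree_of_provable h] at this
  linarith

theorem provDegree_eq_one_mp {φ ψ : Formula L} (h : provDegree Φ (φ.imp ψ) = 1)
    (h' : provDegree Φ φ = 1) : provDegree Φ ψ = 1 := by
  have := provDegree_mp (Φ := Φ) φ ψ
  exact le_antisymm (provDegree_mem Φ ψ).2 (by linarith)

theorem provDegree_and_eq_one {φ ψ : Formula L} (h : provDegree Φ φ = 1)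
    (h' : provDegree Φ ψ = 1) : provDegree Φ (φ.and ψ) = 1 := by
  have h1 : provDegree Φ (φ.imp (ψ.imp (φ.and ψ))) = 1 :=
    provDegree_of_provable (Provable.curry (Provable.idt _))
  exact provDegree_eq_one_mp (provDegree_eq_one_mp h1 h) h'

theorem provDegree_conj_eq_one : ∀ {l : List (Formula L)},
    (∀ φ ∈ l, provDegree Φ φ = 1) → provDegree Φ (conj l) = 1
  | [], _ => provDegree_of_provable Provable.const_one
  | [φ], h => h φ (by simp)
  | φ :: ψ :: l, h => provDegree_and_eq_one (h φ (by simp))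
      (provDegree_conj_eq_one fun χ hχ => h χ (List.mem_cons_of_mem _ hχ))

/-- Simultaneous substitution (used for quantifier-free formulas only). -/
def Formula.map (σ : ℕ → Tm L) : Formula L → Formula L
  | .const r => .const r
  | .rel P ts => .rel P fun i => (ts i).subst σ
  | .imp φ ψ => .imp (φ.map σ) (ψ.map σ)
  | .all y φ => .all y φ

/-- Quantifier-free formulas. -/
def Formula.QF : Formula L → Prop
  | .const _ => True
  | .rel _ _ => True
  | .imp φ ψ => φ.QF ∧ ψ.QF
  | .all _ _ => False

theorem subst_congr {σ τ : ℕ → Tm L} (t : Tm L) (h : ∀ x ∈ t.varFinset, σ x = τ x) :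
    t.subst σ = t.subst τ := by
  induction t with
  | var x => exact h x (by simp [FirstOrder.Language.Term.varFinset])
  | func F ts ih =>
    simp only [FirstOrder.Language.Term.subst]
    congr 1
    funext i
    exact ih i fun x hx => h x (by
      simp only [FirstOrder.Language.Term.varFinset, Finset.mem_biUnion]
      exact ⟨i, Finset.mem_univ _, hx⟩)

theorem subst_var (t : Tm L) : t.subst FirstOrder.Language.Term.var = t := by
  induction t with
  | var x => rfl
  | func F ts ih => simp only [FirstOrder.Language.Term.subst]; congr 1; funext i; exact ih i

theorem subst_subst (σ τ : ℕ → Tm L) (t : Tm L) :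
    (t.subst σ).subst τ = t.subst fun x => (σ x).subst τ := by
  induction t with
  | var x => rfl
  | func F ts ih => simp only [FirstOrder.Language.Term.subst]; congr 1; funext i; exact ih i

namespace Formula

theorem map_map (σ τ : ℕ → Tm L) (φ : Formula L) :
    (φ.map σ).map τ = φ.map fun x => (σ x).subst τ := by
  induction φ with
  | const r => rfl
  | rel P ts => simp [map, subst_subst]
  | imp φ ψ h1 h2 => simp [map, h1, h2]
  | all y φ h => rfl

theorem map_var (φ : Formula L) : φ.map FirstOrder.Language.Term.var = φ := by
  induction φ with
  | const r => rfl
  | rel P ts => simp [map, subst_var]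
  | imp φ ψ h1 h2 => simp [map, h1, h2]
  | all y φ h => rfl

theorem QF.map {φ : Formula L} (h : φ.QF) (σ : ℕ → Tm L) : (φ.map σ).QF := by
  induction φ with
  | const r => trivial
  | rel P ts => trivial
  | imp φ ψ h1 h2 => exact ⟨h1 h.1, h2 h.2⟩
  | all y φ _ => exact h.elim

theorem QF.subst_eq {φ : Formula L} (h : φ.QF) (x : ℕ) (t : Tm L) :
    φ.subst x t = φ.map (Function.update FirstOrder.Language.Term.var x t) := by
  induction φ with
  | const r => rfl
  | rel P ts => rfl
  | imp φ ψ h1 h2 => simp [Formula.map, subst, h1 h.1, h2 h.2]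
  | all y φ _ => exact h.elim

theorem QF.substitutable {φ : Formula L} (h : φ.QF) (x : ℕ) (t : Tm L) :
    φ.Substitutable x t := by
  induction φ with
  | const r => trivial
  | rel P ts => trivial
  | imp φ ψ h1 h2 => exact ⟨h1 h.1, h2 h.2⟩
  | all y φ _ => exact h.elim

theorem substitutable_self (x : ℕ) (φ : Formula L) : φ.Substitutable x (.var x) := by
  induction φ with
  | const r => trivial
  | rel P ts => trivial
  | imp φ ψ h1 h2 => exact ⟨h1, h2⟩
  | all y φ h =>
    by_cases hy : y = x
    · left; simp [freeVars, hy]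
    · right; exact ⟨by simpa [FirstOrder.Language.Term.varFinset] using hy, h⟩

theorem subst_self (x : ℕ) (φ : Formula L) : φ.subst x (.var x) = φ := by
  induction φ with
  | const r => rfl
  | rel P ts => simp [subst, subst_var]
  | imp φ ψ h1 h2 => simp [subst, h1, h2]
  | all y φ h => simp [subst, h]

theorem QF.conj {l : List (Formula L)} (h : ∀ φ ∈ l, φ.QF) : (conj l).QF := by
  induction l with
  | nil => trivial
  | cons φ l ih =>
    cases l with
    | nil => exact h φ (by simp)
    | cons ψ l =>
      exact ⟨⟨h φ (by simp), ih fun χ hχ => h χ (List.mem_cons_of_mem _ hχ), trivial⟩, trivial⟩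

theorem map_conj (σ : ℕ → Tm L) (l : List (Formula L)) :
    (Formula.conj l).map σ = Formula.conj (l.map (Formula.map σ)) := by
  induction l with
  | nil => rfl
  | cons φ l ih =>
    cases l with
    | nil => rfl
    | cons ψ l =>
      simp only [Formula.conj, List.map_cons] at ih ⊢
      simp only [Formula.and, neg, map, ih]

theorem map_sim (σ : ℕ → Tm L) (s t : Tm L) :
    (sim s t).map σ = sim (s.subst σ) (t.subst σ) := by
  simp only [sim, map]
  congr 1
  funext i
  fin_cases i <;> rfl

end Formula

theorem Provable.of_all {x : ℕ} {φ : Formula L} (h : Provable Φ (all x φ)) : Provable Φ φ := by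
  have := Provable.all1 (Φ := Φ) x φ (.var x) (substitutable_self x φ)
  rw [subst_self] at this
  exact h.mp this

theorem Provable.of_alls {xs : List ℕ} {φ : Formula L} (h : Provable Φ (alls xs φ)) :
    Provable Φ φ := by
  induction xs with
  | nil => exact h
  | cons x xs ih => exact ih h.of_all

theorem Provable.map_finset {φ : Formula L} (hφ : φ.QF) (h : Provable Φ φ) (S : Finset ℕ) :
    ∀ σ : ℕ → Tm L, (∀ x, x ∉ S → σ x = .var x) → (∀ x ∈ S, ∀ y ∈ S, x ∉ (σ y).varFinset) →
      Provable Φ (φ.map σ) := by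
  induction S using Finset.induction_on with
  | empty =>
    intro σ h1 _
    have : σ = FirstOrder.Language.Term.var := funext fun x => h1 x (by simp)
    rw [this, map_var]
    exact h
  | insert a S ha ih =>
    intro σ h1 h2
    have h3 := ih (Function.update σ a (.var a))
      (fun x hx => by
        by_cases hxa : x = a
        · subst hxa; simp
        · rw [Function.update_of_ne hxa]; exact h1 x (by simp [hx, hxa]))
      (fun x hx y hy => by
        rw [Function.update_of_ne (by rintro rfl; exact ha hy)]
        exact h2 x (by simp [hx]) y (by simp [hy]))
    have hq := hφ.map (Function.update σ a (.var a))
    have h4 := (h3.gen a).mp (.all1 a _ (σ a) (hq.substitutable a (σ a)))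
    rw [hq.subst_eq, map_map] at h4
    convert h4 using 2
    funext x
    by_cases hxa : x = a
    · subst hxa
      simp [FirstOrder.Language.Term.subst]
    · rw [Function.update_of_ne hxa]
      by_cases hx : x ∈ S
      · rw [subst_congr (τ := FirstOrder.Language.Term.var), subst_var]
        intro y hy
        refine Function.update_of_ne ?_ _ _
        rintro rfl
        exact h2 y (by simp) x (by simp [hx]) hy
      · rw [h1 x (by simp [hx, hxa])]
        simp [FirstOrder.Language.Term.subst, Function.update_of_ne hxa]

theorem exists_fresh {k : ℕ} (t : Fin k → Tm L) :
    ∃ e : Fin k → ℕ, Function.Injective e ∧ ∀ i j, e i ∉ (t j).varFinset := by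
  let B : Finset ℕ := Finset.univ.biUnion fun j => (t j).varFinset
  refine ⟨fun i => B.sup id + 1 + i, fun i j h => ?_, fun i j h => ?_⟩
  · apply Fin.ext; simpa using h
  · have h1 : B.sup id + 1 + i ∈ B := Finset.mem_biUnion.2 ⟨j, Finset.mem_univ _, h⟩
    have := Finset.le_sup (f := id) h1
    simp only [id] at this
    omega

theorem Provable.map_fresh {k : ℕ} {e : Fin k → ℕ} {t : Fin k → Tm L}
    (he : Function.Injective e) (hf : ∀ i j, e i ∉ (t j).varFinset) {φ : Formula L}
    (h : Provable Φ φ) (hφ : φ.QF) :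
    Provable Φ (φ.map (Function.extend e t FirstOrder.Language.Term.var)) := by
  refine h.map_finset hφ (Finset.univ.image e) _ ?_ ?_
  · intro x hx
    refine Function.extend_apply' _ _ _ ?_
    rintro ⟨i, rfl⟩
    exact hx (by simp)
  · intro x hx y hy
    obtain ⟨i, -, rfl⟩ := Finset.mem_image.1 hx
    obtain ⟨j, -, rfl⟩ := Finset.mem_image.1 hy
    rw [he.extend_apply]
    exact hf i j

theorem provable_sim_refl (t : Tm L) : Provable Φ (sim t t) := by
  obtain ⟨e, he, hf⟩ := exists_fresh ![t]
  have h := Provable.map_fresh he hf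
    (Provable.of_all (Φ := Φ) (.simAx (SimAxiom.refl (L := L) (e 0)))) trivial
  simpa [map_sim, FirstOrder.Language.Term.subst, he.extend_apply] using h

theorem provable_sim_symm (s t : Tm L) : Provable Φ ((sim s t).imp (sim t s)) := by
  obtain ⟨e, he, hf⟩ := exists_fresh ![s, t]
  have h := Provable.map_fresh he hf
    (Provable.of_all (Φ := Φ) (.of_all (.simAx (SimAxiom.symm (L := L) (e 0) (e 1)
      (by simp [he.eq_iff]))))) ⟨trivial, trivial⟩
  simpa [map_sim, Formula.map, FirstOrder.Language.Term.subst, he.extend_apply] using h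

theorem provable_sim_trans (s t r : Tm L) :
    Provable Φ (((sim s t).and (sim t r)).imp (sim s r)) := by
  obtain ⟨e, he, hf⟩ := exists_fresh ![s, t, r]
  have h := Provable.map_fresh he hf
    (Provable.of_all (Φ := Φ) (.of_all (.of_all (.simAx (SimAxiom.trans (L := L) (e 0) (e 1) (e 2)
      (by simp [he.eq_iff])))))) ⟨⟨⟨trivial, trivial, trivial⟩, trivial⟩, trivial⟩
  simpa [map_sim, Formula.map, Formula.and, Formula.neg, FirstOrder.Language.Term.subst,
    he.extend_apply] using h

theorem exists_fresh_pair {n : ℕ} (s t : Fin n → Tm L) :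
    ∃ x y : Fin n → ℕ, Function.Injective (Sum.elim x y) ∧ ∃ σ : ℕ → Tm L,
      (∀ i, σ (x i) = s i) ∧ (∀ i, σ (y i) = t i) ∧
      ∀ (Φ : Set (Formula L)) (φ : Formula L), Provable Φ φ → φ.QF → Provable Φ (φ.map σ) := by
  obtain ⟨e, he, hf⟩ := exists_fresh (Fin.append s t)
  have h : Sum.elim (fun i => e (Fin.castAdd n i)) (fun i => e (Fin.natAdd n i)) =
      e ∘ finSumFinEquiv := by
    funext i; cases i <;> simp
  refine ⟨fun i => e (Fin.castAdd n i), fun i => e (Fin.natAdd n i), ?_,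
    Function.extend e (Fin.append s t) .var, ?_, ?_, ?_⟩
  · rw [h]; exact he.comp finSumFinEquiv.injective
  · intro i; rw [he.extend_apply]; exact Fin.append_left s t i
  · intro i; rw [he.extend_apply]; exact Fin.append_right s t i
  · intro Φ φ hp hφ; exact Provable.map_fresh he hf hp hφ

theorem provable_congrFun {n : ℕ} (F : L.Functions n) (s t : Fin n → Tm L) :
    Provable Φ ((conj (List.ofFn fun i => sim (s i) (t i))).imp
      (sim (.func F s) (.func F t))) := by
  obtain ⟨x, y, hxy, σ, hx, hy, h⟩ := exists_fresh_pair s t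
  have h1 := h Φ _ (Provable.of_alls (.simAx (SimAxiom.congrFun F x y hxy)))
    ⟨QF.conj (by simp only [List.mem_ofFn]; rintro _ ⟨i, rfl⟩; trivial), trivial⟩
  simpa [Formula.map, map_conj, map_sim, List.map_ofFn, Function.comp_def,
    FirstOrder.Language.Term.subst, hx, hy] using h1

theorem provable_congrRel {n : ℕ} (P : L.Relations n) (s t : Fin n → Tm L) :
    Provable Φ ((conj (List.ofFn fun i => sim (s i) (t i))).imp
      ((rel P s).iff (rel P t))) := by
  obtain ⟨x, y, hxy, σ, hx, hy, h⟩ := exists_fresh_pair s t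
  have h1 := h Φ _ (Provable.of_alls (.simAx (SimAxiom.congrRel P x y hxy)))
    ⟨QF.conj (by simp only [List.mem_ofFn]; rintro _ ⟨i, rfl⟩; trivial),
      ⟨⟨trivial, trivial⟩, ⟨trivial, trivial⟩, trivial⟩, trivial⟩
  simpa [Formula.map, map_conj, map_sim, List.map_ofFn, Function.comp_def, Formula.iff,
    Formula.and, Formula.neg, FirstOrder.Language.Term.subst, hx, hy] using h1

end Derivations

section TermStructure

variable {L : SimLanguage.{u, v}} (Φ : Set (Formula L))

/-- The equivalence of terms over a theory: `t₁ ∼ t₂` iff `|t₁ ≈ t₂|_Φ = 1`. -/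
def termSetoid : Setoid (Tm L) where
  r t₁ t₂ := provDegree Φ (sim t₁ t₂) = 1
  iseqv :=
    { refl := fun t => provDegree_of_provable (provable_sim_refl t)
      symm := fun {s t} h =>
        provDegree_eq_one_mp (provDegree_of_provable (provable_sim_symm s t)) h
      trans := fun {s t r} h h' =>
        provDegree_eq_one_mp (provDegree_of_provable (provable_sim_trans s t r))
          (provDegree_and_eq_one h h') }

/-- The class of a term. -/
def termClass (t : Tm L) : Quotient (termSetoid Φ) := Quotient.mk (termSetoid Φ) t

/-- The term structure of a theory. By `termStruc_fn` and `termStruc_pr`, the function symbols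
act on classes of terms by `F (t̄₁,…,t̄ₙ) =` the class of `F (t₁,…,tₙ)`, and the predicate symbols
have the values `P (t̄₁,…,t̄ₙ) = |P (t₁,…,tₙ)|_Φ`. -/
noncomputable def termStruc : Struc.{u, v, u} L where
  Carrier := Quotient (termSetoid Φ)
  nonempty := ⟨termClass Φ (.var 0)⟩
  fn F c := termClass Φ (.func F fun i => (c i).out)
  pr P c := ⟨provDegree Φ (rel P fun i => (c i).out), provDegree_mem Φ _⟩

theorem termClass_out (t : Tm L) : provDegree Φ (sim (termClass Φ t).out t) = 1 :=
  Quotient.mk_out (s := termSetoid Φ) t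

theorem termStruc_fn {n : ℕ} (F : L.Functions n) (t : Fin n → Tm L) :
    (termStruc Φ).fn F (fun i => termClass Φ (t i)) = termClass Φ (.func F t) := by
  refine Quotient.sound (s := termSetoid Φ) ?_
  refine provDegree_eq_one_mp (provDegree_of_provable (provable_congrFun F _ t)) ?_
  refine provDegree_conj_eq_one ?_
  simp only [List.mem_ofFn]
  rintro _ ⟨i, rfl⟩
  exact termClass_out Φ (t i)

theorem provDegree_rel_congr {n : ℕ} (P : L.Relations n) {s t : Fin n → Tm L}
    (h : ∀ i, provDegree Φ (sim (s i) (t i)) = 1) :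
    provDegree Φ (rel P s) = provDegree Φ (rel P t) := by
  have h1 : provDegree Φ ((rel P s).iff (rel P t)) = 1 := by
    refine provDegree_eq_one_mp (provDegree_of_provable (provable_congrRel P s t)) ?_
    refine provDegree_conj_eq_one ?_
    simp only [List.mem_ofFn]
    rintro _ ⟨i, rfl⟩
    exact h i
  have h2 := provDegree_mono (Φ := Φ) (Provable.and_left ((rel P s).imp (rel P t))
    ((rel P t).imp (rel P s)))
  have h3 := provDegree_mono (Φ := Φ) (Provable.and_right ((rel P s).imp (rel P t))
    ((rel P t).imp (rel P s)))
  have h4 := provDegree_mp (Φ := Φ) (rel P s) (rel P t)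
  have h5 := provDegree_mp (Φ := Φ) (rel P t) (rel P s)
  simp only [Formula.iff] at h1
  exact le_antisymm (by linarith) (by linarith)

theorem termStruc_pr {n : ℕ} (P : L.Relations n) (t : Fin n → Tm L) :
    ((termStruc Φ).pr P (fun i => termClass Φ (t i)) : ℝ) = provDegree Φ (rel P t) :=
  provDegree_rel_congr Φ P fun i => termClass_out Φ (t i)

end TermStructure

/-- `M`, with the family `b` of elements indexed by the variables, is free on the class of all
reduced models of `Φ`: it belongs to the class, and for every reduced model `N` of `Φ` and every
evaluation `e` in `N` there is a unique homomorphism `g` from `M` to `N` with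
`g (b x) = e x` for every variable `x`. -/
def IsFreeModel {L : SimLanguage.{u, v}} (Φ : Set (Formula L)) (M : Struc.{u, v, w} L)
    (b : ℕ → M.Carrier) : Prop :=
  M.IsModel Φ ∧ M.IsReduced ∧
    ∀ N : Struc.{u, v, w'} L, N.IsModel Φ → N.IsReduced → ∀ e : ℕ → N.Carrier,
      ∃! g : M.Carrier → N.Carrier, IsHom M N g ∧ ∀ x, g (b x) = e x

end RPL

/-! The truth value of an atomic formula in the term structure, under an evaluation that sends
each variable `x` to the class of a term `σ x`, is the provability degree of its `σ`-instance.
The rational truth constants extend this equality to evaluated atomic formulas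
(`provDegree_ev`), and for strong conjunctions of them the truth value is at most the provability
degree (`value_le_of_isConjOf`). This one-sided bound is all that the premise of a Horn formula
needs: if `|α → β|_Φ = 1`, then `‖α‖ ≤ |α|_Φ ≤ |β|_Φ = ‖β‖`. Since provability degrees do not
decrease under substitution in quantifier-free formulas (`provDegree_le_map`), a Horn clause of
degree `1` has all its instances of degree `1`, hence truth value `1` in the term structure. The
same comparison gives the axioms of similarity and congruence.

Freeness rests on soundness (`provDegree_le_value`): the degree of a formula is a lower bound for
its truth value in every model. In a reduced model `N`, two terms that are equivalent over the
theory therefore have equal values under any evaluation `e`, so `t ↦ N.eval e t` factors through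
the term structure; the resulting map is a homomorphism, again by soundness, and the only one
extending `e`, since every element of the term structure is the class of a term. -/

namespace RPL

open Formula

variable {L : SimLanguage.{u, v}} {Φ : Set (Formula L)}

/-! ### Truth values in a structure -/

namespace Struc

variable (M : Struc.{u, v, w} L)

theorem value_imp (φ ψ : Formula L) (e : ℕ → M.Carrier) :
    M.value e (φ.imp ψ) = min (1 - M.value e φ + M.value e ψ) 1 := rfl

theorem value_imp_eq_one {φ ψ : Formula L} {e : ℕ → M.Carrier} :
    M.value e (φ.imp ψ) = 1 ↔ M.value e φ ≤ M.value e ψ := by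
  simp only [value, min_eq_right_iff]
  constructor <;> intro h <;> linarith

theorem value_iff_eq_one {φ ψ : Formula L} {e : ℕ → M.Carrier}
    (h : M.value e φ = M.value e ψ) : M.value e (φ.iff ψ) = 1 := by
  rw [Formula.iff, value_and, (M.value_imp_eq_one).2 h.le, (M.value_imp_eq_one).2 h.ge]
  norm_num

theorem bddBelow_value (x : ℕ) (φ : Formula L) (e : ℕ → M.Carrier) :
    BddBelow (Set.range fun a => M.value (Function.update e x a) φ) :=
  ⟨0, by rintro _ ⟨a, rfl⟩; exact (M.value_mem _ _).1⟩

theorem value_all_le (x : ℕ) (φ : Formula L) (e : ℕ → M.Carrier) (a : M.Carrier) :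
    M.value e (all x φ) ≤ M.value (Function.update e x a) φ :=
  ciInf_le (M.bddBelow_value x φ e) a

theorem value_all_eq_one {x : ℕ} {φ : Formula L} {e : ℕ → M.Carrier}
    (h : ∀ a, M.value (Function.update e x a) φ = 1) : M.value e (all x φ) = 1 := by
  have := M.nonempty
  simp only [value, h, ciInf_const]

theorem value_alls_eq_one {φ : Formula L} (h : ∀ e, M.value e φ = 1) (xs : List ℕ)
    (e : ℕ → M.Carrier) : M.value e (alls xs φ) = 1 := by
  induction xs generalizing e with
  | nil => exact h e
  | cons x xs ih => exact M.value_all_eq_one fun a => ih _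

theorem truth_eq_one_iff {φ : Formula L} : M.truth φ = 1 ↔ ∀ e, M.value e φ = 1 := by
  have := M.nonempty
  constructor
  · intro h e
    refine le_antisymm (M.value_mem φ e).2 (h ▸ ciInf_le ?_ e)
    exact ⟨0, by rintro _ ⟨e, rfl⟩; exact (M.value_mem _ _).1⟩
  · intro h
    simp only [truth, h, ciInf_const]

theorem eval_congr {e e' : ℕ → M.Carrier} (t : Tm L) (h : ∀ x ∈ t.varFinset, e x = e' x) :
    M.eval e t = M.eval e' t := by
  induction t with
  | var x => exact h x (by simp [FirstOrder.Language.Term.varFinset])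
  | func F ts ih =>
    simp only [eval]
    congr 1
    funext i
    exact ih i fun x hx => h x (by
      simp only [FirstOrder.Language.Term.varFinset, Finset.mem_biUnion]
      exact ⟨i, Finset.mem_univ _, hx⟩)

theorem eval_subst (e : ℕ → M.Carrier) (σ : ℕ → Tm L) (t : Tm L) :
    M.eval e (t.subst σ) = M.eval (fun x => M.eval e (σ x)) t := by
  induction t with
  | var x => rfl
  | func F ts ih =>
    simp only [FirstOrder.Language.Term.subst, eval]
    congr 1
    funext i
    exact ih i

theorem eval_subst_update (e : ℕ → M.Carrier) (x : ℕ) (s t : Tm L) :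
    M.eval e (t.subst (Function.update FirstOrder.Language.Term.var x s)) =
      M.eval (Function.update e x (M.eval e s)) t := by
  rw [eval_subst]
  congr 1
  funext y
  by_cases h : y = x
  · subst h; simp
  · simp [Function.update_of_ne h, eval]

theorem value_congr {e e' : ℕ → M.Carrier} (φ : Formula L) (h : ∀ x ∈ φ.freeVars, e x = e' x) :
    M.value e φ = M.value e' φ := by
  induction φ generalizing e e' with
  | const r => rfl
  | rel P ts =>
    simp only [value]
    congr 2
    funext i
    exact M.eval_congr _ fun x hx => h x (Finset.mem_biUnion.2 ⟨i, Finset.mem_univ _, hx⟩)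
  | imp φ ψ h1 h2 =>
    simp only [value, h1 fun x hx => h x (Finset.mem_union_left _ hx),
      h2 fun x hx => h x (Finset.mem_union_right _ hx)]
  | all y φ ih =>
    simp only [value]
    congr 1
    funext a
    refine ih fun x hx => ?_
    by_cases hxy : x = y
    · subst hxy; simp
    · simp only [Function.update_of_ne hxy]
      exact h x (Finset.mem_erase.2 ⟨hxy, hx⟩)

end Struc

theorem Formula.subst_of_notMem {x : ℕ} (t : Tm L) {φ : Formula L} (h : x ∉ φ.freeVars) :
    φ.subst x t = φ := by
  induction φ with
  | const r => rfl
  | rel P ts =>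
    simp only [freeVars, Finset.mem_biUnion, Finset.mem_univ, true_and, not_exists] at h
    simp only [Formula.subst]
    congr 1
    funext i
    rw [subst_congr (τ := FirstOrder.Language.Term.var), subst_var]
    exact fun y hy => Function.update_of_ne (by rintro rfl; exact h i hy) _ _
  | imp φ ψ h1 h2 =>
    simp only [freeVars, Finset.mem_union, not_or] at h
    simp only [Formula.subst, h1 h.1, h2 h.2]
  | all y φ ih =>
    by_cases hy : y = x
    · simp [Formula.subst, hy]
    · have : x ∉ φ.freeVars := fun hx => h (Finset.mem_erase.2 ⟨Ne.symm hy, hx⟩)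
      simp [Formula.subst, ih this]

theorem Struc.value_subst (M : Struc.{u, v, w} L) {x : ℕ} {t : Tm L} {φ : Formula L}
    (h : φ.Substitutable x t) (e : ℕ → M.Carrier) :
    M.value e (φ.subst x t) = M.value (Function.update e x (M.eval e t)) φ := by
  induction φ generalizing e with
  | const r => rfl
  | rel P ts => simp only [Formula.subst, value, eval_subst_update]
  | imp φ ψ h1 h2 => simp only [Formula.subst, value, h1 h.1, h2 h.2]
  | all y φ ih =>
    by_cases hx : x ∈ (all y φ).freeVars
    · obtain ⟨hyt, hφ⟩ := h.resolve_left (not_not.2 hx)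
      have hxy : x ≠ y := (Finset.mem_erase.1 hx).1
      simp only [Formula.subst, if_neg hxy.symm, value]
      congr 1
      funext a
      rw [ih hφ, Function.update_comm hxy, M.eval_congr (e' := e) t]
      exact fun z hz => Function.update_of_ne (by rintro rfl; exact hyt hz) _ _
    · rw [Formula.subst_of_notMem t hx]
      exact M.value_congr _ fun z hz =>
        (Function.update_of_ne (by rintro rfl; exact hx hz) _ _).symm

/-! ### Soundness -/

theorem Provable.value_eq_one {N : Struc.{u, v, w} L} (hN : N.IsModel Φ) {φ : Formula L}
    (h : Provable Φ φ) (e : ℕ → N.Carrier) : N.value e φ = 1 := by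
  induction h generalizing e with
  | hyp h => exact N.truth_eq_one_iff.1 (hN.2 _ h) e
  | luk1 φ ψ =>
    have h1 := N.value_mem φ e
    have h2 := N.value_mem ψ e
    rw [N.value_imp_eq_one]
    exact le_min (by linarith [h2.2]) h1.2
  | luk2 φ ψ ξ =>
    rw [N.value_imp_eq_one]
    simp only [Struc.value]
    refine le_min ?_ (min_le_right _ _)
    rcases min_cases (1 - N.value e ψ + N.value e ξ) 1 with h1 | h1 <;>
    rcases min_cases (1 - N.value e φ + N.value e ψ) 1 with h2 | h2 <;>
    rcases min_cases (1 - N.value e φ + N.value e ξ) 1 with h3 | h3 <;> linarith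
  | luk3 φ ψ =>
    rw [N.value_imp_eq_one, Struc.value, Struc.value_neg, Struc.value_neg, Struc.value]
    exact le_of_eq (by ring_nf)
  | luk4 φ ψ =>
    rw [N.value_imp_eq_one]
    simp only [Struc.value]
    have h1 := N.value_mem φ e
    have h2 := N.value_mem ψ e
    -- both sides are the maximum of the two values
    rcases le_total (N.value e φ) (N.value e ψ) with h | h
    · rw [min_eq_right (a := 1 - N.value e φ + N.value e ψ) (by linarith),
        min_eq_left (a := 1 - N.value e ψ + N.value e φ) (by linarith)]
      exact le_min (by linarith [min_le_left (1 - 1 + N.value e ψ) 1]) (min_le_right _ _)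
    · rw [min_eq_left (a := 1 - N.value e φ + N.value e ψ) (by linarith),
        min_eq_right (a := 1 - N.value e ψ + N.value e φ) (by linarith)]
      refine le_min ?_ (min_le_right _ _)
      linarith [min_le_left (1 - (1 - N.value e φ + N.value e ψ) + N.value e ψ) 1]
  | rpl1 r s =>
    refine N.value_iff_eq_one ?_
    simp [Struc.value, QI.imp]
  | rpl2 r s =>
    refine N.value_iff_eq_one ?_
    rw [N.value_and]
    simp [Struc.value, QI.and]
  | all1 x φ t h =>
    rw [N.value_imp_eq_one, N.value_subst h]
    exact N.value_all_le x φ e _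
  | all2 x ξ φ h =>
    have := N.nonempty
    rw [N.value_imp_eq_one]
    refine le_min ?_ (N.value_mem _ e).2
    have h1 : N.value e (all x (ξ.imp φ)) - 1 + N.value e ξ ≤ N.value e (all x φ) := by
      refine le_ciInf fun a => ?_
      have h2 := (N.value_all_le x (ξ.imp φ) e a).trans (min_le_left _ _)
      rw [N.value_congr (e' := e) ξ
        fun y hy => Function.update_of_ne (by rintro rfl; exact h hy) _ _] at h2
      linarith
    linarith
  | simAx h => exact N.truth_eq_one_iff.1 (hN.1 _ h) e
  | mp _ _ h1 h2 =>
    have h3 := N.value_imp_eq_one.1 (h2 e)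
    rw [h1 e] at h3
    exact le_antisymm (N.value_mem _ e).2 h3
  | gen x _ ih => exact N.value_all_eq_one fun a => ih _

/-- Soundness in graded form. -/
theorem provDegree_le_value {N : Struc.{u, v, w} L} (hN : N.IsModel Φ) (φ : Formula L)
    (e : ℕ → N.Carrier) : provDegree Φ φ ≤ N.value e φ := by
  refine csSup_le ⟨0, 0, by simp, Provable.exF φ⟩ ?_
  rintro _ ⟨r, rfl, hr⟩
  exact N.value_imp_eq_one.1 (hr.value_eq_one hN e)

/-! ### Substitution in quantifier-free formulas -/

theorem Formula.QF.map_congr {σ τ : ℕ → Tm L} {φ : Formula L} (hφ : φ.QF)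
    (h : ∀ x ∈ φ.freeVars, σ x = τ x) : φ.map σ = φ.map τ := by
  induction φ with
  | const r => rfl
  | rel P ts =>
    simp only [Formula.map]
    congr 1
    funext i
    exact subst_congr _ fun x hx => h x (Finset.mem_biUnion.2 ⟨i, Finset.mem_univ _, hx⟩)
  | imp φ ψ h1 h2 =>
    simp only [Formula.map, h1 hφ.1 fun x hx => h x (Finset.mem_union_left _ hx),
      h2 hφ.2 fun x hx => h x (Finset.mem_union_right _ hx)]
  | all y φ _ => exact hφ.elim

/-- Provable quantifier-free formulas are closed under every simultaneous substitution. The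
variables are renamed to fresh ones and those replaced by the terms, so that both substitutions
can be carried out one variable at a time. -/
theorem Provable.map {φ : Formula L} (hφ : φ.QF) (h : Provable Φ φ) (σ : ℕ → Tm L) :
    Provable Φ (φ.map σ) := by
  let S := φ.freeVars
  let B : Finset ℕ := S ∪ S.biUnion fun x => (σ x).varFinset
  let m := B.sup id + 1
  have hm : ∀ x ∈ B, x < m := fun x hx => Nat.lt_succ_of_le (Finset.le_sup (f := id) hx)
  have hS : ∀ x ∈ S, x < m := fun x hx => hm x (Finset.mem_union_left _ hx)
  have h1 : Provable Φ (φ.map fun x => if x ∈ S then .var (m + x) else .var x) := by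
    refine h.map_finset hφ S _ (fun x hx => if_neg hx) fun x hx y hy => ?_
    have := hS x hx
    simp only [if_pos hy, FirstOrder.Language.Term.varFinset, Finset.mem_singleton]
    omega
  have h2 := h1.map_finset (hφ.map _) (S.image (m + ·))
    (fun x => if x ∈ S.image (m + ·) then σ (x - m) else .var x) (fun x hx => if_neg hx)
    (fun x hx y hy => by
      simp only [if_pos hy]
      obtain ⟨a, ha, rfl⟩ := Finset.mem_image.1 hx
      obtain ⟨b, hb, rfl⟩ := Finset.mem_image.1 hy
      intro hc
      rw [Nat.add_sub_cancel_left] at hc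
      have := hm _ (Finset.mem_union_right _ (Finset.mem_biUnion.2 ⟨b, hb, hc⟩))
      omega)
  rw [map_map] at h2
  convert h2 using 1
  refine hφ.map_congr fun x hx => ?_
  have hx' : x ∈ S := hx
  simp [hx', FirstOrder.Language.Term.subst]

theorem provDegree_le_map {φ : Formula L} (hφ : φ.QF) (σ : ℕ → Tm L) :
    provDegree Φ φ ≤ provDegree Φ (φ.map σ) := by
  refine csSup_le ⟨0, 0, by simp, Provable.exF φ⟩ ?_
  rintro _ ⟨r, rfl, hr⟩
  exact le_provDegree (hr.map (φ := (const r).imp φ) ⟨trivial, hφ⟩ σ)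

theorem provable_alls_imp (xs : List ℕ) (φ : Formula L) : Provable Φ ((alls xs φ).imp φ) := by
  induction xs with
  | nil => exact .idt φ
  | cons x xs ih =>
    have h := Provable.all1 (Φ := Φ) x (alls xs φ) (.var x) (substitutable_self x _)
    rw [subst_self] at h
    exact h.tr ih

/-! ### Provability degrees of compound formulas -/

theorem provDegree_and_le_left (φ ψ : Formula L) :
    provDegree Φ (φ.and ψ) ≤ provDegree Φ φ := provDegree_mono (.and_left φ ψ)

theorem provDegree_and_le_right (φ ψ : Formula L) :
    provDegree Φ (φ.and ψ) ≤ provDegree Φ ψ := provDegree_mono (.and_right φ ψ)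

theorem le_provDegree_and (φ ψ : Formula L) :
    max (provDegree Φ φ + provDegree Φ ψ - 1) 0 ≤ provDegree Φ (φ.and ψ) := by
  refine max_le ?_ (provDegree_mem Φ _).1
  have h1 := provDegree_mono (Φ := Φ) (Provable.curry (.idt (φ.and ψ)))
  have h2 := provDegree_mp (Φ := Φ) ψ (φ.and ψ)
  linarith

theorem provDegree_imp_le (φ ψ : Formula L) :
    provDegree Φ (φ.imp ψ) ≤ min (1 - provDegree Φ φ + provDegree Φ ψ) 1 :=
  le_min (by linarith [provDegree_mp (Φ := Φ) φ ψ]) (provDegree_mem Φ _).2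

/-- Prefixing a truth constant acts on provability degrees as it does on truth values. -/
theorem provDegree_ev (φ : Formula L) (r : QI) :
    provDegree Φ (φ.ev r) = min (1 - ((r : ℚ) : ℝ) + provDegree Φ φ) 1 := by
  apply le_antisymm
  · refine (provDegree_imp_le _ _).trans (min_le_min_right _ ?_)
    linarith [le_provDegree (Φ := Φ) (Provable.idt (const r))]
  · refine le_of_forall_pos_le_add fun ε hε => ?_
    obtain ⟨s, hs, h⟩ := exists_of_lt_provDegree (Φ := Φ) (φ := φ)
      (q := provDegree Φ φ - ε) (by linarith)
    have h1 : Provable Φ ((const (r.imp s)).imp (φ.ev r)) :=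
      (Provable.mp (.rpl1 r s) (.and_right _ _)).tr
        (.mp h (.exch (.luk2 (const r) (const s) φ)))
    have h2 := le_provDegree h1
    simp only [QI.imp, Rat.cast_min, Rat.cast_add, Rat.cast_sub, Rat.cast_one] at h2
    rcases min_le_iff.1 h2 with h3 | h3
    · exact (min_le_left _ _).trans (by linarith)
    · exact (min_le_right _ _).trans (by linarith)

/-! ### Truth values in the term structure -/

section TermStructure

variable (σ : ℕ → Tm L)

/-- The evaluation in the term structure that sends each variable `x` to the class of `σ x`. -/
def classEval (Φ : Set (Formula L)) (σ : ℕ → Tm L) : ℕ → (termStruc Φ).Carrier :=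
  fun x => termClass Φ (σ x)

theorem termStruc_eval (t : Tm L) :
    (termStruc Φ).eval (classEval Φ σ) t = termClass Φ (t.subst σ) := by
  induction t with
  | var x => rfl
  | func F ts ih =>
    simp only [Struc.eval, ih, FirstOrder.Language.Term.subst]
    exact termStruc_fn Φ F _

theorem termStruc_value_rel {n : ℕ} (P : L.Relations n) (ts : Fin n → Tm L) :
    (termStruc Φ).value (classEval Φ σ) (rel P ts) =
      provDegree Φ ((rel P ts).map σ) := by
  simp only [Struc.value, termStruc_eval]
  exact termStruc_pr Φ P _

theorem termStruc_value_sim (s t : Tm L) :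
    (termStruc Φ).value (classEval Φ σ) (sim s t) =
      provDegree Φ (sim (s.subst σ) (t.subst σ)) := by
  rw [← map_sim]
  exact termStruc_value_rel σ _ _

theorem exists_eq_termClass (e : ℕ → (termStruc Φ).Carrier) :
    ∃ σ : ℕ → Tm L, e = classEval Φ σ :=
  ⟨fun x => Quotient.out (s := termSetoid Φ) (e x),
    funext fun x => (Quotient.out_eq (s := termSetoid Φ) (e x)).symm⟩

theorem Formula.IsEvAtomic.value_eq {φ : Formula L} (h : φ.IsEvAtomic) :
    (termStruc Φ).value (classEval Φ σ) φ = provDegree Φ (φ.map σ) := by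
  obtain ⟨P, ts, r⟩ := h
  have h1 := provDegree_ev (Φ := Φ) ((rel P ts).map σ) r
  rw [← termStruc_value_rel] at h1
  exact h1.symm

/-- In the term structure the truth value of a strong conjunction is at most its provability
degree, provided that this holds for its members. -/
theorem value_le_of_isConjOf {S : Formula L → Prop}
    (hS : ∀ φ, S φ →
      (termStruc Φ).value (classEval Φ σ) φ ≤ provDegree Φ (φ.map σ))
    {φ : Formula L} (h : IsConjOf S φ) :
    (termStruc Φ).value (classEval Φ σ) φ ≤ provDegree Φ (φ.map σ) := by
  induction h with
  | single h => exact hS _ h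
  | @and φ ψ _ _ h1 h2 =>
    rw [Struc.value_and]
    exact (max_le_max_right _ (by linarith)).trans
      (le_provDegree_and (φ.map σ) (ψ.map σ))

theorem isConjOf_conj {S : Formula L → Prop} :
    ∀ {l : List (Formula L)}, l ≠ [] → (∀ φ ∈ l, S φ) → IsConjOf S (conj l)
  | [], h, _ => absurd rfl h
  | [φ], _, h => .single (φ := φ) (h φ (by simp))
  | _ :: _ :: _, _, h => .and (.single (h _ (by simp)))
      (isConjOf_conj (by simp) fun χ hχ => h χ (List.mem_cons_of_mem _ hχ))

theorem value_conj_sim_le {n : ℕ} (x y : Fin n → ℕ) :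
    (termStruc Φ).value (classEval Φ σ)
        (conj (List.ofFn fun i => sim (.var (x i)) (.var (y i)))) ≤
      provDegree Φ (conj (List.ofFn fun i => sim (σ (x i)) (σ (y i)))) := by
  cases n with
  | zero =>
    simp only [List.ofFn_zero, conj]
    rw [provDegree_of_provable .const_one]
    exact (Struc.value_mem _ _ _).2
  | succ n =>
    have h := value_le_of_isConjOf (Φ := Φ) σ (S := fun φ => ∃ s t, φ = sim s t)
      (by
        rintro _ ⟨s, t, rfl⟩
        rw [map_sim]
        exact (termStruc_value_sim σ s t).le)
      (isConjOf_conj (l := List.ofFn fun i => sim (.var (x i)) (.var (y i))) (by simp)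
        (by simp only [List.mem_ofFn]; rintro _ ⟨i, rfl⟩; exact ⟨_, _, rfl⟩))
    simpa [map_conj, map_sim, List.map_ofFn, Function.comp_def,
      FirstOrder.Language.Term.subst] using h

/-! ### Horn clauses in the term structure -/

theorem Formula.IsEvAtomic.qf {φ : Formula L} (h : φ.IsEvAtomic) : φ.QF := by
  obtain ⟨P, ts, r⟩ := h
  exact ⟨trivial, trivial⟩

theorem Formula.IsConjOf.qf {S : Formula L → Prop} (hS : ∀ φ, S φ → φ.QF) {φ : Formula L}
    (h : IsConjOf S φ) : φ.QF := by
  induction h with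
  | single h => exact hS _ h
  | and _ _ h1 h2 => exact ⟨⟨h1, h2, trivial⟩, trivial⟩

theorem Formula.IsBasicHorn.qf {φ : Formula L} (h : φ.IsBasicHorn) : φ.QF := by
  cases h with
  | ev h => exact h.qf
  | imp h1 h2 => exact ⟨h1.qf fun _ => IsEvAtomic.qf, h2.qf⟩

theorem Formula.IsQFHorn.qf {φ : Formula L} (h : φ.IsQFHorn) : φ.QF :=
  IsConjOf.qf (fun _ => IsBasicHorn.qf) h

theorem Formula.IsBasicHorn.value_eq_one {φ : Formula L} (h : φ.IsBasicHorn)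
    (hd : provDegree Φ (φ.map σ) = 1) :
    (termStruc Φ).value (classEval Φ σ) φ = 1 := by
  cases h with
  | ev h => rw [h.value_eq, hd]
  | @imp α β h1 h2 =>
    rw [Struc.value_imp_eq_one, h2.value_eq]
    refine (value_le_of_isConjOf σ (fun φ h => (h.value_eq σ).le) h1).trans ?_
    have h3 := provDegree_mp (Φ := Φ) (α.map σ) (β.map σ)
    have h4 : provDegree Φ ((α.map σ).imp (β.map σ)) = 1 := hd
    linarith

theorem Formula.IsQFHorn.value_eq_one {φ : Formula L} (h : φ.IsQFHorn)
    (hd : provDegree Φ (φ.map σ) = 1) :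
    (termStruc Φ).value (classEval Φ σ) φ = 1 := by
  induction h with
  | single h => exact h.value_eq_one σ hd
  | @and φ ψ _ _ h1 h2 =>
    have hd' : provDegree Φ ((φ.map σ).and (ψ.map σ)) = 1 := hd
    have hφ := provDegree_and_le_left (Φ := Φ) (φ.map σ) (ψ.map σ)
    have hψ := provDegree_and_le_right (Φ := Φ) (φ.map σ) (ψ.map σ)
    rw [Struc.value_and, h1 (le_antisymm (provDegree_mem Φ _).2 (hd' ▸ hφ)),
      h2 (le_antisymm (provDegree_mem Φ _).2 (hd' ▸ hψ))]
    norm_num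

end TermStructure

theorem Formula.IsHornClause.truth_eq_one {φ : Formula L} (h : φ.IsHornClause)
    (hd : provDegree Φ φ = 1) : (termStruc Φ).truth φ = 1 := by
  obtain ⟨xs, γ, hγ, rfl⟩ := h
  refine (Struc.truth_eq_one_iff _).2 (Struc.value_alls_eq_one _ (fun e => ?_) xs)
  obtain ⟨σ, rfl⟩ := exists_eq_termClass e
  refine hγ.value_eq_one σ (le_antisymm (provDegree_mem Φ _).2 ?_)
  rw [← hd]
  exact (provDegree_mono (provable_alls_imp xs γ)).trans (provDegree_le_map hγ.qf σ)

/-! ### The term structure as a free model -/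

theorem termStruc_simAxiom {φ : Formula L} (h : SimAxiom φ) : (termStruc Φ).truth φ = 1 := by
  rw [Struc.truth_eq_one_iff]
  cases h with
  | refl x =>
    refine Struc.value_alls_eq_one _ (fun e => ?_) [x]
    obtain ⟨σ, rfl⟩ := exists_eq_termClass e
    exact (termStruc_value_sim σ (.var x) (.var x)).trans
      (provDegree_of_provable (provable_sim_refl _))
  | symm x y =>
    refine Struc.value_alls_eq_one _ (fun e => ?_) [x, y]
    obtain ⟨σ, rfl⟩ := exists_eq_termClass e
    rw [Struc.value_imp_eq_one, termStruc_value_sim, termStruc_value_sim]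
    exact provDegree_mono (provable_sim_symm _ _)
  | trans x y z =>
    refine Struc.value_alls_eq_one _ (fun e => ?_) [x, y, z]
    obtain ⟨σ, rfl⟩ := exists_eq_termClass e
    rw [Struc.value_imp_eq_one, Struc.value_and, termStruc_value_sim, termStruc_value_sim,
      termStruc_value_sim]
    exact (le_provDegree_and _ _).trans (provDegree_mono (provable_sim_trans _ _ _))
  | congrFun F x y =>
    refine Struc.value_alls_eq_one _ (fun e => ?_) _
    obtain ⟨σ, rfl⟩ := exists_eq_termClass e
    rw [Struc.value_imp_eq_one, termStruc_value_sim]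
    exact (value_conj_sim_le σ x y).trans (provDegree_mono (provable_congrFun F _ _))
  | congrRel P x y =>
    refine Struc.value_alls_eq_one _ (fun e => ?_) _
    obtain ⟨σ, rfl⟩ := exists_eq_termClass e
    rw [Struc.value_imp_eq_one]
    refine ((value_conj_sim_le σ x y).trans (provDegree_mono (provable_congrRel P _ _))).trans ?_
    rw [Formula.iff, Formula.iff, Struc.value_and, Struc.value_imp, Struc.value_imp,
      termStruc_value_rel, termStruc_value_rel]
    set a := rel P fun i => σ (x i)
    set b := rel P fun i => σ (y i)
    have h1 := (provDegree_and_le_left (Φ := Φ) (a.imp b) (b.imp a)).trans (provDegree_imp_le _ _)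
    have h2 := (provDegree_and_le_right (Φ := Φ) (a.imp b) (b.imp a)).trans
      (provDegree_imp_le _ _)
    change _ ≤ max (min (1 - provDegree Φ a + provDegree Φ b) 1 +
      min (1 - provDegree Φ b + provDegree Φ a) 1 - 1) 0
    -- one of the two implications has value `1`, so the conjunction takes the value of the other
    refine le_max_of_le_left ?_
    rcases le_total (provDegree Φ a) (provDegree Φ b) with h | h
    · rw [min_eq_right (a := 1 - provDegree Φ a + provDegree Φ b) (by linarith)]
      linarith
    · rw [min_eq_right (a := 1 - provDegree Φ b + provDegree Φ a) (by linarith)]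
      linarith

theorem termStruc_isModel (hΦ : ∀ φ ∈ Φ, φ.IsHornClause) : (termStruc Φ).IsModel Φ :=
  ⟨fun _ => termStruc_simAxiom, fun φ hφ =>
    (hΦ φ hφ).truth_eq_one (provDegree_of_provable (.hyp hφ))⟩

theorem termStruc_isReduced : (termStruc Φ).IsReduced := by
  intro d e
  induction d using Quotient.inductionOn with | h s => ?_
  induction e using Quotient.inductionOn with | h t => ?_
  have h : ((termStruc Φ).pr L.sim ![termClass Φ s, termClass Φ t] : ℝ) =
      provDegree Φ (sim s t) := by
    rw [sim, ← termStruc_pr]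
    congr 2
    funext i
    fin_cases i <;> rfl
  change (termStruc Φ).pr L.sim ![termClass Φ s, termClass Φ t] = 1 ↔ _
  rw [Subtype.ext_iff, h]
  exact Quotient.eq (r := termSetoid Φ).symm

theorem Struc.IsReduced.eval_eq {N : Struc.{u, v, w} L} (hN : N.IsModel Φ) (hr : N.IsReduced)
    {s t : Tm L} (h : provDegree Φ (sim s t) = 1) (e : ℕ → N.Carrier) :
    N.eval e s = N.eval e t := by
  rw [← hr]
  have h1 := provDegree_le_value hN (sim s t) e
  rw [h] at h1
  refine Subtype.ext (le_antisymm (N.pr _ _).2.2 (h1.trans_eq ?_))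
  simp only [sim, value]
  congr 2
  funext i
  fin_cases i <;> rfl

/-- The universal property of the term structure. It holds for every theory; Horn clauses are
needed only for the term structure to be a model itself. -/
theorem existsUnique_isHom_termStruc {N : Struc.{u, v, w} L} (hN : N.IsModel Φ)
    (hr : N.IsReduced) (e : ℕ → N.Carrier) :
    ∃! g : (termStruc Φ).Carrier → N.Carrier,
      IsHom (termStruc Φ) N g ∧ ∀ x, g (termClass Φ (.var x)) = e x := by
  refine ⟨Quotient.lift (s := termSetoid Φ) (N.eval e) fun s t h => hr.eval_eq hN h e,
    ⟨⟨fun F d => ?_, fun P d h => ?_⟩, fun x => rfl⟩, ?_⟩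
  · obtain ⟨t, rfl⟩ : ∃ t : _ → Tm L, d = fun i => termClass Φ (t i) :=
      ⟨fun i => Quotient.out (s := termSetoid Φ) (d i),
        funext fun i => (Quotient.out_eq (s := termSetoid Φ) (d i)).symm⟩
    rw [termStruc_fn]
    rfl
  · obtain ⟨t, rfl⟩ : ∃ t : _ → Tm L, d = fun i => termClass Φ (t i) :=
      ⟨fun i => Quotient.out (s := termSetoid Φ) (d i),
        funext fun i => (Quotient.out_eq (s := termSetoid Φ) (d i)).symm⟩
    have h1 := provDegree_le_value hN (rel P t) e
    rw [← termStruc_pr, h] at h1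
    exact Subtype.ext (le_antisymm (N.pr _ _).2.2 h1)
  · rintro g ⟨hg, hx⟩
    funext d
    induction d using Quotient.inductionOn with | h t => ?_
    change g (termClass Φ t) = N.eval e t
    induction t with
    | var x => exact hx x
    | func F ts ih =>
      rw [← termStruc_fn]
      refine (hg.map_fn F _).trans ?_
      simp only [ih, Struc.eval]

end RPL

theorem theorem4p4 (L : RPL.SimLanguage.{u, v}) (Φ : Set (RPL.Formula L))
    (hΦ : RPL.IsTheory Φ) (hcon : RPL.IsConsistent Φ) :
    (∀ φ : RPL.Formula L, φ.IsHornClause → φ.IsSentence → RPL.provDegree Φ φ = 1 →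
      (RPL.termStruc Φ).truth φ = 1) ∧
    ((∀ φ ∈ Φ, φ.IsHornClause) →
      (RPL.termStruc Φ).IsModel Φ ∧
      RPL.IsFreeModel.{u, v, u, w} Φ (RPL.termStruc Φ) fun x => RPL.termClass Φ (.var x)) :=
  ⟨fun _ hφ _ hd => hφ.truth_eq_one hd, fun h =>
    ⟨RPL.termStruc_isModel h, RPL.termStruc_isModel h, RPL.termStruc_isReduced,
      fun _ hN hr e => RPL.existsUnique_isHom_termStruc hN hr e⟩⟩
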